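/- Fix an integer $k\ge 0$. Let $\mathcal L$ be the set of all line segments joining two consecutive integral points on a line of slope $0$, $\infty$ or $-1$ through integral points of $\mathbb Z^2$. Let $p,q$ be coprime integers with $p\neq 0$, $q\neq 0$ and $p+q\neq 0$ (that is, the straight segment $\gamma$ from $(0,0)$ to $(p,q)$, oriented towards $(p,q)$, does not run along a line of $\mathcal L$). Let $\tau_1,\dots,\tau_n$ be the line segments of $\mathcal L$ whose interiors are crossed by $\gamma$, in the order in which $\gamma$ crosses them. The fence poset $\mathcal P_{(p,q)}$ has the elements $(\tau_i,j)$, $1\le i\le n$, $0\le j\le k$, and the order generated by the following relations: $(\tau_i,0)\succ(\tau_i,1)\succ\cdots\succ(\tau_i,k)$ if the crossing point of $\gamma$ with $\tau_i$ is strictly closer to the endpoint of $\tau_i$ lying to the right of $\gamma$, and $(\tau_i,0)\prec(\tau_i,1)\prec\cdots\prec(\tau_i,k)$ otherwise; and, for $1\le i<n$, $(\tau_i,k)\succ(\tau_{i+1},0)$ if the common endpoint of $\tau_i$ and $\tau_{i+1}$ lies to the right of $\gamma$, and $(\tau_i,k)\prec(\tau_{i+1},0)$ if it lies to the left. Write $h=n(k+1)$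 and list the elements along $\gamma$ as $\mathcal P_{(p,q)}(1)=(\tau_1,0),\dots,\mathcal P_{(p,q)}(h)=(\tau_n,k)$. Let $m^{(k)}_{\frac qp}$ be the number of order ideals (downward closed subsets, including $\emptyset$) of $\mathcal P_{(p,q)}$. Let $\mathcal P^\circ_{\frac qp}$ be the poset whose elements are those of $\mathcal P_{(p,q)}$ together with $3k+3$ new elements $H(1),\dots,H(3k+3)$, with the order generated by that of $\mathcal P_{(p,q)}$ and the relations $H(i)\succ H(i+1)$ for $1\le i<3k+3$, $H(3k+3)\prec \mathcal P_{(p,q)}(1)$ and $\mathcal P_{(p,q)}(h)\prec H(1)$. Then the number of order ideals of $\mathcal P^\circ_{\frac qp}$ is $(3+3k)\,m^{(k)}_{\frac qp}-k$. -/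

import Mathlib

namespace KMarkov

/-- The directions of the lines of slope `0`, `∞` and `-1`. -/
inductive Dir
  | horizontal
  | vertical
  | diagonal

/-- The vector between consecutive integral points on a line of the given direction. -/
def Dir.vec : Dir → ℤ × ℤ
  | .horizontal => (1, 0)
  | .vertical => (0, 1)
  | .diagonal => (-1, 1)

/-- A line segment of the lattice `𝓛`: it joins two consecutive integral points on a line of
slope `0`, `∞` or `-1` through integral points. -/
structure Edge where
  src : ℤ × ℤ
  dir : Dir

/-- The second endpoint of a line segment of `𝓛`. -/
def Edge.tgt (τ : Edge) : ℤ × ℤ := τ.src + τ.dir.vec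

/-- `v` is an endpoint of the line segment `τ`. -/
def Edge.IsEndpoint (τ : Edge) (v : ℤ × ℤ) : Prop := v = τ.src ∨ v = τ.tgt

/-- `v` lies strictly to the left of the line through the origin directed towards `(p, q)`. -/
def LeftOf (p q : ℤ) (v : ℤ × ℤ) : Prop := 0 < p * v.2 - q * v.1

/-- `v` lies strictly to the right of the line through the origin directed towards `(p, q)`. -/
def RightOf (p q : ℤ) (v : ℤ × ℤ) : Prop := p * v.2 - q * v.1 < 0

/-- A crossing of the straight segment `γ` from `(0,0)` to `(p,q)` with a line segment of `𝓛`: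
the two open segments meet transversally in the point `t • (p, q)`, which is also the point of
`edge` at parameter `s` (`s = 0` is `edge.src`, `s = 1` is `edge.tgt`). By transversality `s` and
`t` are determined by `edge`. -/
structure Crossing (p q : ℤ) where
  edge : Edge
  s : ℝ
  t : ℝ
  s_pos : 0 < s
  s_lt_one : s < 1
  t_pos : 0 < t
  t_lt_one : t < 1
  meet_fst : (edge.src.1 : ℝ) + s * (edge.dir.vec.1 : ℝ) = t * (p : ℝ)
  meet_snd : (edge.src.2 : ℝ) + s * (edge.dir.vec.2 : ℝ) = t * (q : ℝ)
  transversal : p * edge.dir.vec.2 - q * edge.dir.vec.1 ≠ 0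

/-- The intersection point is strictly closer to the endpoint of the line segment that lies to
the right of `γ`. -/
def Crossing.CloserToRight {p q : ℤ} (c : Crossing p q) : Prop :=
  (RightOf p q c.edge.src ∧ c.s < 1 / 2) ∨ (RightOf p q c.edge.tgt ∧ 1 / 2 < c.s)

/-- `γ` crosses the line segments of `c` and `c'` consecutively, in this order. -/
def Crossing.Consecutive {p q : ℤ} (c c' : Crossing p q) : Prop :=
  c.t < c'.t ∧ ∀ d : Crossing p q, ¬ (c.t < d.t ∧ d.t < c'.t)

/-- The underlying set of the fence poset of the segment `γ` from `(0,0)` to `(p,q)`: the pairs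
`(τ, i)` where `τ` is a crossed line segment and `0 ≤ i ≤ k`. -/
@[ext] structure Fence (k : ℕ) (p q : ℤ) where
  crossing : Crossing p q
  level : Fin (k + 1)

/-- A relation that only relates neighbours of a linear order, each pair in one direction, has an
antisymmetric reflexive transitive closure. -/
theorem antisymm_of_neighbours {α β : Type*} [LinearOrder β] (f : α → β)
    (hf : Function.Injective f) (R : α → α → Prop)
    (hadj : ∀ x y, R x y → (f x < f y ∧ ∀ z, ¬ (f x < f z ∧ f z < f y)) ∨
      (f y < f x ∧ ∀ z, ¬ (f y < f z ∧ f z < f x)))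
    (hasym : ∀ x y, R x y → ¬ R y x) {x y : α} (hxy : Relation.ReflTransGen R x y)
    (hyx : Relation.ReflTransGen R y x) : x = y := by
  rcases hxy.cases_head with h | ⟨z, hxz, hzy⟩
  · exact h
  exfalso
  have hzx := hzy.trans hyx
  rcases hadj x z hxz with ⟨h1, h2⟩ | ⟨h1, h2⟩
  · have key : ∀ w, Relation.ReflTransGen R z w → f z ≤ f w := by
      intro w hw
      induction hw with
      | refl => exact le_rfl
      | @tail b c _ hbc ih =>
        rcases hadj b c hbc with ⟨h3, _⟩ | ⟨h3, h4⟩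
        · exact ih.trans h3.le
        · by_contra hlt
          rw [not_le] at hlt
          have hzb : z = b := by
            by_contra hne
            exact h4 z ⟨hlt, lt_of_le_of_ne ih (fun h => hne (hf h))⟩
          subst hzb
          have hcx : c = x := by
            apply hf
            rcases lt_trichotomy (f c) (f x) with h | h | h
            · exact absurd ⟨h, h1⟩ (h4 x)
            · exact h
            · exact absurd ⟨h, h3⟩ (h2 c)
          subst hcx
          exact hasym _ _ hxz hbc
    exact absurd (key x hzx) (not_le.mpr h1)
  · have key : ∀ w, Relation.ReflTransGen R z w → f w ≤ f z := by
      intro w hw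
      induction hw with
      | refl => exact le_rfl
      | @tail b c _ hbc ih =>
        rcases hadj b c hbc with ⟨h3, h4⟩ | ⟨h3, _⟩
        · by_contra hlt
          rw [not_le] at hlt
          have hzb : z = b := by
            by_contra hne
            exact h4 z ⟨lt_of_le_of_ne ih (fun h => hne (hf h.symm)), hlt⟩
          subst hzb
          have hcx : c = x := by
            apply hf
            rcases lt_trichotomy (f c) (f x) with h | h | h
            · exact absurd ⟨h3, h⟩ (h2 c)
            · exact h
            · exact absurd ⟨h1, h⟩ (h4 x)
          subst hcx
          exact hasym _ _ hxz hbc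
        · exact h3.le.trans ih
    exact absurd (key x hzx) (not_le.mpr h1)

theorem int_eq_of_add_eq {a b : ℤ} {s s' : ℝ} (h0 : 0 < s) (h1 : s < 1) (h0' : 0 < s')
    (h1' : s' < 1) (h : (a : ℝ) + s = b + s') : a = b := by
  have h2 : ((a : ℝ)) < b + 1 := by linarith
  have h3 : ((b : ℝ)) < a + 1 := by linarith
  norm_cast at h2 h3
  omega

theorem int_ne_add {a b : ℤ} {s : ℝ} (h0 : 0 < s) (h1 : s < 1) : (a : ℝ) + s ≠ b := by
  intro h
  have h2 : ((a : ℝ)) < b := by linarith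
  have h3 : ((b : ℝ)) < a + 1 := by linarith
  norm_cast at h2 h3
  omega

/-- Different crossings occur at different times. -/
theorem Crossing.t_injective {p q : ℤ} :
    Function.Injective (fun c : Crossing p q => c.t) := by
  rintro ⟨⟨⟨a, b⟩, d⟩, s, t, s0, s1, t0, t1, m1, m2, tr⟩
    ⟨⟨⟨a', b'⟩, d'⟩, s', t', s0', s1', t0', t1', m1', m2', tr'⟩ h
  simp only at h
  subst h
  rw [← m1] at m1'
  rw [← m2] at m2'
  have main : d = d' ∧ a = a' ∧ b = b' ∧ s = s' := by
    cases d <;> cases d' <;>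
      simp only [Dir.vec, Int.cast_one, Int.cast_zero, mul_one, mul_zero, add_zero,
        Int.cast_neg, mul_neg] at m1' m2'
    · have ha := int_eq_of_add_eq s0' s1' s0 s1 m1'
      subst ha
      exact ⟨rfl, rfl, by exact_mod_cast m2'.symm, by linarith⟩
    · exact absurd m2' (int_ne_add s0' s1')
    · exact absurd m2' (int_ne_add s0' s1')
    · exact absurd m2'.symm (int_ne_add s0 s1)
    · have hb := int_eq_of_add_eq s0' s1' s0 s1 m2'
      subst hb
      exact ⟨rfl, by exact_mod_cast m1'.symm, rfl, by linarith⟩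
    · exact absurd (by linarith : (a : ℝ) + s' = a') (int_ne_add s0' s1')
    · exact absurd m2'.symm (int_ne_add s0 s1)
    · exact absurd (by linarith : (a' : ℝ) + s = a) (int_ne_add s0 s1)
    · have hb := int_eq_of_add_eq s0' s1' s0 s1 m2'
      subst hb
      have hs : s = s' := by linarith
      subst hs
      exact ⟨rfl, by exact_mod_cast (by linarith : (a : ℝ) = a'), rfl, rfl⟩
  obtain ⟨rfl, rfl, rfl, rfl⟩ := main
  rfl

/-- A line segment is determined by two different endpoints. -/
theorem Edge.eq_of_endpoints {τ τ' : Edge} {v w : ℤ × ℤ} (hvw : v ≠ w) (h1 : τ.IsEndpoint v)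
    (h2 : τ.IsEndpoint w) (h3 : τ'.IsEndpoint v) (h4 : τ'.IsEndpoint w) : τ = τ' := by
  obtain ⟨⟨a, b⟩, d⟩ := τ
  obtain ⟨⟨a', b'⟩, d'⟩ := τ'
  obtain ⟨x, y⟩ := v
  obtain ⟨x', y'⟩ := w
  cases d <;> cases d' <;>
    simp only [Edge.IsEndpoint, Edge.tgt, Dir.vec, Prod.mk_add_mk, Prod.mk.injEq, ne_eq,
      Edge.mk.injEq, and_true, reduceCtorEq, and_false] at * <;> omega

namespace Fence

/-- The generating relations `x ≺ y` of the fence poset. -/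
inductive Step {k : ℕ} {p q : ℤ} : Fence k p q → Fence k p q → Prop
  | chainDown (c : Crossing p q) (i : Fin k) (h : c.CloserToRight) :
      Step ⟨c, i.succ⟩ ⟨c, i.castSucc⟩
  | chainUp (c : Crossing p q) (i : Fin k) (h : ¬ c.CloserToRight) :
      Step ⟨c, i.castSucc⟩ ⟨c, i.succ⟩
  | linkDown (c c' : Crossing p q) (v : ℤ × ℤ) (h : c.Consecutive c')
      (hc : c.edge.IsEndpoint v) (hc' : c'.edge.IsEndpoint v) (hv : RightOf p q v) :
      Step ⟨c', 0⟩ ⟨c, Fin.last k⟩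
  | linkUp (c c' : Crossing p q) (v : ℤ × ℤ) (h : c.Consecutive c')
      (hc : c.edge.IsEndpoint v) (hc' : c'.edge.IsEndpoint v) (hv : LeftOf p q v) :
      Step ⟨c, Fin.last k⟩ ⟨c', 0⟩

/-- The place of an element in the left-to-right reading of the fence along `γ`. -/
noncomputable def place {k : ℕ} {p q : ℤ} (x : Fence k p q) : ℝ ×ₗ Fin (k + 1) :=
  toLex (x.crossing.t, x.level)

theorem place_injective {k : ℕ} {p q : ℤ} :
    Function.Injective (place : Fence k p q → ℝ ×ₗ Fin (k + 1)) := by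
  intro x y h
  have h' : (x.crossing.t, x.level) = (y.crossing.t, y.level) := h
  rw [Prod.mk.injEq] at h'
  exact Fence.ext (Crossing.t_injective h'.1) h'.2

theorem place_lt {k : ℕ} {p q : ℤ} {x y : Fence k p q} :
    place x < place y ↔ x.crossing.t < y.crossing.t ∨
      (x.crossing.t = y.crossing.t ∧ x.level < y.level) := by
  simp [place, Prod.Lex.toLex_lt_toLex]

theorem chain_neighbours {k : ℕ} {p q : ℤ} (c : Crossing p q) (i : Fin k) :
    place (⟨c, i.castSucc⟩ : Fence k p q) < place (⟨c, i.succ⟩ : Fence k p q) ∧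
      ∀ z : Fence k p q, ¬ (place (⟨c, i.castSucc⟩ : Fence k p q) < place z ∧
        place z < place (⟨c, i.succ⟩ : Fence k p q)) := by
  refine ⟨place_lt.mpr (Or.inr ⟨rfl, Fin.castSucc_lt_succ⟩), ?_⟩
  rintro ⟨d, j⟩ ⟨h1, h2⟩
  rw [place_lt] at h1 h2
  simp only [Fin.lt_def, Fin.val_castSucc, Fin.val_succ] at h1 h2
  rcases h1 with h1 | ⟨h1, h1'⟩ <;> rcases h2 with h2 | ⟨h2, h2'⟩
  · exact lt_asymm h1 h2
  · exact h1.ne h2.symm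
  · exact h2.ne h1.symm
  · omega

theorem link_neighbours {k : ℕ} {p q : ℤ} (c c' : Crossing p q) (h : c.Consecutive c') :
    place (⟨c, Fin.last k⟩ : Fence k p q) < place (⟨c', 0⟩ : Fence k p q) ∧
      ∀ z : Fence k p q, ¬ (place (⟨c, Fin.last k⟩ : Fence k p q) < place z ∧
        place z < place (⟨c', 0⟩ : Fence k p q)) := by
  refine ⟨place_lt.mpr (Or.inl h.1), ?_⟩
  rintro ⟨d, j⟩ ⟨h1, h2⟩
  rw [place_lt] at h1 h2
  rcases h1 with h1 | ⟨_, h1'⟩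
  · rcases h2 with h2 | ⟨_, h2'⟩
    · exact h.2 d ⟨h1, h2⟩
    · exact absurd h2' (Fin.not_lt_zero _)
  · exact absurd (Fin.le_last j) (not_le.mpr h1')

theorem Step.neighbours {k : ℕ} {p q : ℤ} (x y : Fence k p q) (h : Step x y) :
    (place x < place y ∧ ∀ z : Fence k p q, ¬ (place x < place z ∧ place z < place y)) ∨
      (place y < place x ∧ ∀ z : Fence k p q, ¬ (place y < place z ∧ place z < place x)) := by
  cases h with
  | chainDown c i h => exact Or.inr (chain_neighbours c i)
  | chainUp c i h => exact Or.inl (chain_neighbours c i)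
  | linkDown c c' v h hc hc' hv => exact Or.inr (link_neighbours c c' h)
  | linkUp c c' v h hc hc' hv => exact Or.inl (link_neighbours c c' h)

theorem Step.asymm {k : ℕ} {p q : ℤ} (x y : Fence k p q) (h : Step x y) : ¬ Step y x := by
  have hlink : ∀ (c c' : Crossing p q) (v w : ℤ × ℤ), c.Consecutive c' → c.edge.IsEndpoint v →
      c'.edge.IsEndpoint v → RightOf p q v → c.edge.IsEndpoint w → c'.edge.IsEndpoint w →
      ¬ LeftOf p q w := by
    intro c c' v w h h1 h2 h3 h4 h5 h6
    have hne : v ≠ w := by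
      rintro rfl
      exact lt_asymm h3 h6
    have he := Edge.eq_of_endpoints hne h1 h4 h2 h5
    have hp : (0 : ℝ) < c'.t - c.t := sub_pos.mpr h.1
    obtain ⟨τ, s, t, s0, s1, t0, t1, m1, m2, tr⟩ := c
    obtain ⟨τ', s', t', s0', s1', t0', t1', m1', m2', tr'⟩ := c'
    simp only at he hp
    subst he
    have tr2 : (p : ℝ) * τ.dir.vec.2 - q * τ.dir.vec.1 ≠ 0 := by exact_mod_cast tr
    have e : (s' - s) * ((p : ℝ) * τ.dir.vec.2 - q * τ.dir.vec.1) = 0 := by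
      linear_combination p * (m2' - m2) - q * (m1' - m1)
    have es : s' = s := by
      rcases mul_eq_zero.mp e with e | e
      · linarith
      · exact absurd e tr2
    subst es
    have e1 : (t' - t) * (p : ℝ) = 0 := by linarith
    have e2 : (t' - t) * (q : ℝ) = 0 := by linarith
    have hp0 : (p : ℝ) = 0 := (mul_eq_zero.mp e1).resolve_left hp.ne'
    have hq0 : (q : ℝ) = 0 := (mul_eq_zero.mp e2).resolve_left hp.ne'
    exact tr2 (by rw [hp0, hq0]; ring)
  intro h'
  cases h with
  | chainDown c i h =>
    generalize hx : (⟨c, i.succ⟩ : Fence k p q) = x at h'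
    generalize hy : (⟨c, i.castSucc⟩ : Fence k p q) = y at h'
    cases h' with
    | chainDown c' j h' =>
      simp only [Fence.mk.injEq, Fin.ext_iff, Fin.val_castSucc, Fin.val_succ] at hx hy
      omega
    | chainUp c' j h' =>
      simp only [Fence.mk.injEq] at hx
      exact h' (hx.1 ▸ h)
    | linkDown c₁ c₂ v hh _ _ _ =>
      simp only [Fence.mk.injEq] at hx hy
      exact hh.1.ne (by rw [← hx.1, ← hy.1])
    | linkUp c₁ c₂ v hh _ _ _ =>
      simp only [Fence.mk.injEq] at hx hy
      exact hh.1.ne (by rw [← hx.1, ← hy.1])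
  | chainUp c i h =>
    generalize hx : (⟨c, i.castSucc⟩ : Fence k p q) = x at h'
    generalize hy : (⟨c, i.succ⟩ : Fence k p q) = y at h'
    cases h' with
    | chainDown c' j h' =>
      simp only [Fence.mk.injEq] at hx
      exact h (hx.1 ▸ h')
    | chainUp c' j h' =>
      simp only [Fence.mk.injEq, Fin.ext_iff, Fin.val_castSucc, Fin.val_succ] at hx hy
      omega
    | linkDown c₁ c₂ v hh _ _ _ =>
      simp only [Fence.mk.injEq] at hx hy
      exact hh.1.ne (by rw [← hx.1, ← hy.1])
    | linkUp c₁ c₂ v hh _ _ _ =>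
      simp only [Fence.mk.injEq] at hx hy
      exact hh.1.ne (by rw [← hx.1, ← hy.1])
  | linkDown c c' v h hc hc' hv =>
    generalize hx : (⟨c', 0⟩ : Fence k p q) = x at h'
    generalize hy : (⟨c, Fin.last k⟩ : Fence k p q) = y at h'
    cases h' with
    | chainDown d j _ =>
      simp only [Fence.mk.injEq] at hx hy
      exact h.1.ne (by rw [hx.1, hy.1])
    | chainUp d j _ =>
      simp only [Fence.mk.injEq] at hx hy
      exact h.1.ne (by rw [hx.1, hy.1])
    | linkDown c₁ c₂ w hh _ _ _ =>
      simp only [Fence.mk.injEq] at hx hy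
      rw [← hx.1, ← hy.1] at hh
      exact lt_asymm h.1 hh.1
    | linkUp c₁ c₂ w hh h1 h2 h3 =>
      simp only [Fence.mk.injEq] at hx hy
      rw [← hy.1] at h1
      rw [← hx.1] at h2
      exact hlink c c' v w h hc hc' hv h1 h2 h3
  | linkUp c c' v h hc hc' hv =>
    generalize hx : (⟨c, Fin.last k⟩ : Fence k p q) = x at h'
    generalize hy : (⟨c', 0⟩ : Fence k p q) = y at h'
    cases h' with
    | chainDown d j _ =>
      simp only [Fence.mk.injEq] at hx hy
      exact h.1.ne (by rw [hx.1, hy.1])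
    | chainUp d j _ =>
      simp only [Fence.mk.injEq] at hx hy
      exact h.1.ne (by rw [hx.1, hy.1])
    | linkUp c₁ c₂ w hh _ _ _ =>
      simp only [Fence.mk.injEq] at hx hy
      rw [← hx.1, ← hy.1] at hh
      exact lt_asymm h.1 hh.1
    | linkDown c₁ c₂ w hh h1 h2 h3 =>
      simp only [Fence.mk.injEq] at hx hy
      rw [← hx.1] at h1
      rw [← hy.1] at h2
      exact hlink c c' w v h h1 h2 h3 hc hc' hv

/-- The fence poset of the segment from `(0,0)` to `(p,q)`; for coprime `p`, `q` it is
`𝓟_{(p,q)}`. Its order is the reflexive transitive closure of the generating relations. -/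
instance instPartialOrder (k : ℕ) (p q : ℤ) : PartialOrder (Fence k p q) where
  le := Relation.ReflTransGen Step
  le_refl _ := Relation.ReflTransGen.refl
  le_trans _ _ _ h h' := Relation.ReflTransGen.trans h h'
  le_antisymm _ _ h h' :=
    antisymm_of_neighbours place place_injective Step Step.neighbours Step.asymm h h'

/-- `x` is the first element of the fence, in the reading along `γ` from `(0,0)` to `(p,q)`. -/
def IsFirst {k : ℕ} {p q : ℤ} (x : Fence k p q) : Prop :=
  x.level = 0 ∧ ∀ d : Crossing p q, x.crossing.t ≤ d.t

/-- `x` is the last element of the fence, in the reading along `γ` from `(0,0)` to `(p,q)`. -/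
def IsLast {k : ℕ} {p q : ℤ} (x : Fence k p q) : Prop :=
  x.level = Fin.last k ∧ ∀ d : Crossing p q, d.t ≤ x.crossing.t

end Fence

/-- For coprime `p`, `q`: the number `m^{(k)}_{(p,q)}` of order ideals of `𝓟_{(p,q)}`. -/
noncomputable def markov (k : ℕ) (p q : ℤ) : ℕ := Nat.card (LowerSet (Fence k p q))

/-- The underlying set of the circular poset `𝓟°_{(p,q)}`: a chain `H(0), …, H(3k+2)` of `3k+3`
new elements, followed by the elements of the fence poset. -/
inductive Circular (k : ℕ) (p q : ℤ)
  | chain (i : Fin (3 * k + 3))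
  | fence (x : Fence k p q)

namespace Circular

/-- The generating relations `x ≺ y` of the circular poset: those of the fence poset, the chain
`H(0) ≻ H(1) ≻ ⋯ ≻ H(3k+2)`, the relation `H(3k+2) ≺ first element of the fence`, and the relation
`last element of the fence ≺ H(0)`. -/
inductive Step {k : ℕ} {p q : ℤ} : Circular k p q → Circular k p q → Prop
  | fence (x y : Fence k p q) (h : x ≤ y) : Step (.fence x) (.fence y)
  | chain (i : Fin (3 * k + 2)) : Step (.chain i.succ) (.chain i.castSucc)
  | toFirst (x : Fence k p q) (h : x.IsFirst) : Step (.chain (Fin.last (3 * k + 2))) (.fence x)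
  | fromLast (x : Fence k p q) (h : x.IsLast) : Step (.fence x) (.chain 0)

/-- An explicit relation containing the closure of the generating relations; it is used only to
show that the closure is antisymmetric. -/
def Bound {k : ℕ} {p q : ℤ} : Circular k p q → Circular k p q → Prop
  | .chain i, .chain j => j ≤ i
  | .chain i, .fence _ => i = Fin.last (3 * k + 2)
  | .fence _, .chain j => j = 0
  | .fence x, .fence y => x ≤ y

theorem bound_of_closure {k : ℕ} {p q : ℤ} {x y : Circular k p q}
    (h : Relation.ReflTransGen Step x y) : Bound x y := by
  induction h with
  | refl => cases x <;> exact le_rfl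
  | @tail b c _ hbc ih =>
    cases hbc with
    | fence u v h =>
      cases x with
      | chain i => exact ih
      | fence w => exact le_trans (show w ≤ u from ih) h
    | chain i =>
      cases x with
      | chain j => exact le_trans Fin.castSucc_lt_succ.le (show i.succ ≤ j from ih)
      | fence w => exact absurd (show i.succ = 0 from ih) (Fin.succ_ne_zero i)
    | toFirst u h =>
      cases x with
      | chain j => exact le_antisymm (Fin.le_last j) ih
      | fence w =>
        have h0 : Fin.last (3 * k + 2) = 0 := ih
        simp [Fin.ext_iff] at h0
    | fromLast u h =>
      cases x with
      | chain j => exact Fin.zero_le j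
      | fence w => exact rfl

/-- The circular poset `𝓟°_{(p,q)}` (for coprime `p`, `q`). -/
instance instPartialOrder (k : ℕ) (p q : ℤ) : PartialOrder (Circular k p q) where
  le := Relation.ReflTransGen Step
  le_refl _ := Relation.ReflTransGen.refl
  le_trans _ _ _ h h' := Relation.ReflTransGen.trans h h'
  le_antisymm x y h h' := by
    have h1 := bound_of_closure h
    have h2 := bound_of_closure h'
    cases x with
    | chain i =>
      cases y with
      | chain j => exact congrArg _ (le_antisymm (show i ≤ j from h2) (show j ≤ i from h1))
      | fence w =>
        have h3 : i = Fin.last (3 * k + 2) := h1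
        have h4 : i = 0 := h2
        rw [h3] at h4
        simp [Fin.ext_iff] at h4
    | fence u =>
      cases y with
      | chain j =>
        have h3 : j = 0 := h1
        have h4 : j = Fin.last (3 * k + 2) := h2
        rw [h3] at h4
        simp [Fin.ext_iff] at h4
      | fence w => exact congrArg _ (le_antisymm (show u ≤ w from h1) (show w ≤ u from h2))

end Circular

end KMarkov

/-! Let `x₀`, `x₁` be the first and last element of the fence. An ideal of the circular poset is an
ideal `I` of the fence together with a final segment of the chain. Of the `3k + 4` final segments,
the empty one is ruled out exactly when `x₀ ∈ I`, and the full one exactly when `x₁ ∉ I`; so `I`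
extends in `3k + 3 - [x₀ ∈ I] + [x₁ ∈ I]` ways. Summing over `I` (`Circular.card_lowerSet`) leaves
one claim: exactly `k` more ideals contain `x₀` than contain `x₁`.

Reading the fence along `γ` gives a word of rises and falls. The product `P` of the corresponding
2×2 transfer matrices counts ideals by their membership at the two ends, and the wanted difference
is `P true false - P false true`. The half turn about the midpoint of `γ` reverses the reading but
keeps the relations, so the word equals its reversal with rises and falls exchanged, except at the
crossing through the midpoint, where the tie-break produces `k` rises. Hence `P = X K Xᵀ` with `K -
Kᵀ = k J`, `J` alternating. Since `det X = 1`, `X J Xᵀ = J`, and therefore `P - Pᵀ = k J`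
(`pathMatrix_sub_transpose`).

The geometric input is that `γ` bisects an edge at its own midpoint and nowhere else
(`Crossing.exists_middle`, `Crossing.t_eq_half_of_s_eq_half`), and that consecutively crossed edges
share an endpoint, so that all neighbours in the reading are related
(`Crossing.Consecutive.exists_common_endpoint`). -/

namespace KMarkov

/-! ### Transfer matrices of words of rises and falls -/

/-- Membership indicators `a`, `b` of two neighbours `x`, `y` in a down-closed set, where `u` says
whether `x ≺ y` or `y ≺ x`. -/
def compat (u a b : Bool) : Bool := if u then (!b || a) else (!a || b)

/-- The transfer matrix of a single relation between neighbours. -/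
def transfer (u : Bool) : Matrix Bool Bool ℤ := Matrix.of fun a b => if compat u a b then 1 else 0

theorem transfer_not (u : Bool) : transfer (!u) = (transfer u).transpose := by
  ext a b
  cases u <;> cases a <;> cases b <;> rfl

/-- The standard alternating matrix. -/
def alternating : Matrix Bool Bool ℤ :=
  Matrix.of fun a b => if a = b then 0 else if a then 1 else -1

/-- For 2×2 matrices `M J Mᵀ = det M • J`, and transfer matrices are unitriangular. -/
theorem transfer_mul_alternating_mul_transpose (u : Bool) :
    transfer u * alternating * (transfer u).transpose = alternating := by
  ext a b
  cases u <;> cases a <;> cases b <;> rfl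

/-- The product of the transfer matrices of the first `n` letters of `r`. -/
def pathMatrix (r : ℕ → Bool) : ℕ → Matrix Bool Bool ℤ
  | 0 => 1
  | n + 1 => pathMatrix r n * transfer (r n)

theorem pathMatrix_add (r : ℕ → Bool) (m n : ℕ) :
    pathMatrix r (m + n) = pathMatrix r m * pathMatrix (fun i => r (m + i)) n := by
  induction n with
  | zero => simp [pathMatrix]
  | succ n ih =>
    rw [← add_assoc]
    simp only [pathMatrix]
    rw [ih, mul_assoc]

/-- Transposition reverses the order of the factors and, by `transfer_not`, flips every letter. -/
theorem pathMatrix_reverse (r s : ℕ → Bool) (n : ℕ) (h : ∀ i < n, s i = !r (n - 1 - i)) :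
    pathMatrix s n = (pathMatrix r n).transpose := by
  induction n generalizing s with
  | zero => simp [pathMatrix]
  | succ n ih =>
    -- The first letter of `s` is split off, because it mirrors the last letter of `r`.
    rw [add_comm n 1, pathMatrix_add, add_comm 1 n]
    rw [ih (fun i => s (1 + i)) fun i hi => by
      rw [h _ (by omega)]; congr 2; omega]
    have h0 : s 0 = !r n := by rw [h 0 (by omega)]; congr 2
    simp only [pathMatrix, Matrix.transpose_mul, one_mul, h0, transfer_not]

theorem pathMatrix_mul_alternating_mul_transpose (r : ℕ → Bool) (n : ℕ) :
    pathMatrix r n * alternating * (pathMatrix r n).transpose = alternating := by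
  induction n with
  | zero => simp [pathMatrix]
  | succ n ih =>
    simp only [pathMatrix, Matrix.transpose_mul]
    calc _ = pathMatrix r n * (transfer (r n) * alternating * (transfer (r n)).transpose) *
          (pathMatrix r n).transpose := by simp only [mul_assoc]
      _ = _ := by rw [transfer_mul_alternating_mul_transpose, ih]

/-- A power of a unipotent matrix: its corner entry is what finally contributes the `k`. -/
theorem pathMatrix_true (r : ℕ → Bool) (n : ℕ) (h : ∀ i < n, r i = true) :
    pathMatrix r n =
      Matrix.of fun a b => if a = b then 1 else if a then (n : ℤ) else 0 := by
  induction n with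
  | zero =>
    ext a b
    cases a <;> cases b <;> simp [pathMatrix]
  | succ n ih =>
    simp only [pathMatrix]
    rw [ih fun i hi => h i (by omega), h n (by omega)]
    ext a b
    cases a <;> cases b <;> simp [Matrix.mul_apply, transfer, compat, add_comm]

/-- A word that is up to a block of `k` rises invariant under reversal and exchange of rises and
falls. -/
theorem pathMatrix_sub_transpose (r : ℕ → Bool) (a k : ℕ) (hmid : ∀ i < k, r (a + i) = true)
    (hsymm : ∀ i < a, r (2 * a + k - 1 - i) = !r i) :
    pathMatrix r (2 * a + k) true false - pathMatrix r (2 * a + k) false true = k := by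
  set X := pathMatrix r a with hX
  set K := pathMatrix (fun i => r (a + i)) k with hK
  have h1 : pathMatrix r (2 * a + k) = X * K * X.transpose := by
    rw [show 2 * a + k = a + k + a by ring, pathMatrix_add, pathMatrix_add,
      pathMatrix_reverse r (fun i => r (a + k + i)) a fun i hi => by
        rw [← hsymm _ (by omega)]; congr 1; omega]
  have h2 : K - K.transpose = (k : ℤ) • alternating := by
    rw [hK, pathMatrix_true _ _ hmid]
    ext a b
    cases a <;> cases b <;> simp [alternating]
  have h3 : pathMatrix r (2 * a + k) - (pathMatrix r (2 * a + k)).transpose =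
      (k : ℤ) • alternating := by
    rw [h1]
    calc _ = X * (K - K.transpose) * X.transpose := by
          simp only [Matrix.transpose_mul, Matrix.transpose_transpose, mul_sub, sub_mul, mul_assoc]
      _ = (k : ℤ) • (X * alternating * X.transpose) := by
          rw [h2, Matrix.mul_smul, Matrix.smul_mul]
      _ = _ := by rw [hX, pathMatrix_mul_alternating_mul_transpose]
  have h4 := congrFun (congrFun h3 true) false
  simpa [alternating] using h4

/-! ### Ideals of a fence as paths -/

/-- Summation over all paths through the transfer matrices. -/
theorem sum_paths (r : ℕ → Bool) (n : ℕ) (f g : Bool → ℤ) :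
    ∑ s : Fin (n + 1) → Bool, f (s 0) *
      (∏ i : Fin n, transfer (r i) (s i.castSucc) (s i.succ)) * g (s (Fin.last n)) =
      ∑ x, ∑ y, f x * pathMatrix r n x y * g y := by
  induction n generalizing g with
  | zero =>
    rw [← (Equiv.funUnique (Fin 1) Bool).symm.sum_comp]
    simp [pathMatrix, Matrix.one_apply]
  | succ n ih =>
    rw [← (Fin.snocEquiv fun _ : Fin (n + 2) => Bool).sum_comp, Fintype.sum_prod_type_right]
    -- The last letter is absorbed into the weight at the end of the shorter path.
    have h := ih fun z => ∑ b, transfer (r n) z b * g b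
    calc _ = ∑ s : Fin (n + 1) → Bool, f (s 0) *
          (∏ i : Fin n, transfer (r i) (s i.castSucc) (s i.succ)) *
          ∑ b, transfer (r n) (s (Fin.last n)) b * g b := by
          refine Finset.sum_congr rfl fun s _ => ?_
          rw [Finset.mul_sum]
          refine Finset.sum_congr rfl fun b _ => ?_
          have h0 : (Fin.snoc s b : Fin (n + 2) → Bool) 0 = s 0 := by
            rw [← Fin.castSucc_zero]; exact Fin.snoc_castSucc (α := fun _ => Bool) ..
          simp only [Fin.snocEquiv, Equiv.coe_fn_mk, Fin.prod_univ_castSucc,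
            Fin.snoc_castSucc, Fin.snoc_last, Fin.succ_last, ← Fin.castSucc_succ, h0,
            Fin.val_castSucc, Fin.val_last]
          exact by ring
      _ = _ := by
          rw [h]
          refine Finset.sum_congr rfl fun x _ => ?_
          simp only [pathMatrix, Matrix.mul_apply, Fintype.sum_bool]
          ring

theorem prod_transfer (r : ℕ → Bool) (n : ℕ) (s : Fin (n + 1) → Bool) :
    ∏ i : Fin n, transfer (r i) (s i.castSucc) (s i.succ) =
      if ∀ i : Fin n, compat (r i) (s i.castSucc) (s i.succ) = true then 1 else 0 := by
  split_ifs with h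
  · exact Finset.prod_eq_one fun i _ => by simp [transfer, h i]
  · push Not at h
    obtain ⟨i, hi⟩ := h
    exact Finset.prod_eq_zero (Finset.mem_univ i) (by simp [transfer, hi])

open Classical in
/-- The down-closed sets of a fence, as sequences of indicators. -/
noncomputable def lowerSetEquiv {α : Type*} [PartialOrder α] {n : ℕ} (e : Fin (n + 1) ≃ α)
    (r : ℕ → Bool) (R : α → α → Prop) (hle : ∀ x y : α, x ≤ y ↔ Relation.ReflTransGen R x y)
    (hR : ∀ x y, R x y → ∃ i : Fin n, (x = e i.castSucc ∧ y = e i.succ ∧ r i = true) ∨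
      (x = e i.succ ∧ y = e i.castSucc ∧ r i = false))
    (hup : ∀ i : Fin n, r i = true → R (e i.castSucc) (e i.succ))
    (hdown : ∀ i : Fin n, r i = false → R (e i.succ) (e i.castSucc)) :
    LowerSet α ≃
      {s : Fin (n + 1) → Bool // ∀ i : Fin n, compat (r i) (s i.castSucc) (s i.succ) = true} where
  toFun I := ⟨fun j => decide (e j ∈ I), by
    intro i
    rcases h : r i with _ | _
    · have := I.lower ((hle _ _).2 (.single (hdown i h)))
      simpa [compat, ← imp_iff_not_or] using this
    · have := I.lower ((hle _ _).2 (.single (hup i h)))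
      simp only [compat, if_true, Bool.or_eq_true, Bool.not_eq_true', decide_eq_false_iff_not,
        decide_eq_true_eq, ← imp_iff_not_or]
      exact this⟩
  invFun s := ⟨{x | s.1 (e.symm x) = true}, by
    intro y x hxy hy
    rw [hle] at hxy
    -- The order is generated by `R`, so closure downwards need only be checked across one pair of
    -- neighbours.
    induction hxy using Relation.ReflTransGen.head_induction_on with
    | refl => exact hy
    | head hab _ ih =>
      obtain ⟨i, ⟨rfl, rfl, hi⟩ | ⟨rfl, rfl, hi⟩⟩ := hR _ _ hab
      all_goals
        have := s.2 i
        simp only [Set.mem_ofPred_eq, Equiv.symm_apply_apply] at ih ⊢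
        simpa [hi, compat, ih] using this⟩
  left_inv I := by ext x; simp
  right_inv s := by
    ext x
    rw [Bool.eq_iff_iff, decide_eq_true_iff]
    change s.1 (e.symm (e x)) = true ↔ _
    rw [Equiv.symm_apply_apply]

/-- In a fence whose shape is invariant under reversal up to a rising block with `k` relations in
the middle, there are `k` more ideals containing the first element than ideals containing the last
element. -/
theorem card_first_sub_card_last {α : Type*} [PartialOrder α] {n : ℕ} (e : Fin (n + 1) ≃ α)
    (r : ℕ → Bool) (R : α → α → Prop) (hle : ∀ x y : α, x ≤ y ↔ Relation.ReflTransGen R x y)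
    (hR : ∀ x y, R x y → ∃ i : Fin n, (x = e i.castSucc ∧ y = e i.succ ∧ r i = true) ∨
      (x = e i.succ ∧ y = e i.castSucc ∧ r i = false))
    (hup : ∀ i : Fin n, r i = true → R (e i.castSucc) (e i.succ))
    (hdown : ∀ i : Fin n, r i = false → R (e i.succ) (e i.castSucc))
    (a k : ℕ) (hn : n = 2 * a + k) (hmid : ∀ i < k, r (a + i) = true)
    (hsymm : ∀ i < a, r (2 * a + k - 1 - i) = !r i) :
    (Nat.card {I : LowerSet α // e 0 ∈ I} : ℤ) - Nat.card {I : LowerSet α // e (Fin.last n) ∈ I}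
      = k := by
  have key : ∀ j : Fin (n + 1), (Nat.card {I : LowerSet α // e j ∈ I} : ℤ) =
      ∑ s : Fin (n + 1) → Bool, (if s j = true then 1 else 0) *
        ∏ i : Fin n, transfer (r i) (s i.castSucc) (s i.succ) := by
    intro j
    have h1 : {I : LowerSet α // e j ∈ I} ≃ {s : Fin (n + 1) → Bool //
        (∀ i : Fin n, compat (r i) (s i.castSucc) (s i.succ) = true) ∧ s j = true} :=
      ((lowerSetEquiv e r R hle hR hup hdown).subtypeEquiv
        (q := fun s => s.1 j = true) fun I => by simp [lowerSetEquiv]).trans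
        (Equiv.subtypeSubtypeEquivSubtypeInter (fun s : Fin (n + 1) → Bool =>
          ∀ i : Fin n, compat (r i) (s i.castSucc) (s i.succ) = true) fun s => s j = true)
    rw [Nat.card_congr h1, Nat.card_eq_fintype_card, Fintype.card_subtype, Finset.card_filter]
    push_cast
    refine Finset.sum_congr rfl fun s _ => ?_
    rw [prod_transfer]
    split_ifs <;> simp_all
  have h0 := sum_paths r n (fun x => if x = true then 1 else 0) fun _ => 1
  have h1 := sum_paths r n (fun _ => 1) fun x => if x = true then 1 else 0
  rw [key, key]
  simp only [mul_one, one_mul, Fintype.sum_bool, if_true, Bool.false_eq_true, if_false, mul_zero,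
    zero_mul, add_zero] at h0 h1
  simp only [h0]
  rw [Finset.sum_congr rfl fun s _ => mul_comm _ _, h1]
  -- The ideals containing both ends, counted by the entry `true true`, cancel in the difference.
  have h2 := pathMatrix_sub_transpose r a k hmid hsymm
  rw [← hn] at h2
  linarith

/-! ### Crossings: finiteness and sides -/

variable {k : ℕ} {p q : ℤ}

namespace Crossing

/-- The crossed line segment determines the crossing. -/
theorem edge_injective : Function.Injective (fun c : Crossing p q => c.edge) := by
  rintro ⟨τ, s, t, s0, s1, t0, t1, m1, m2, tr⟩ ⟨τ', s', t', s0', s1', t0', t1', m1', m2', tr'⟩ h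
  simp only at h
  subst h
  have tr2 : (p : ℝ) * τ.dir.vec.2 - q * τ.dir.vec.1 ≠ 0 := by exact_mod_cast tr
  have es : s' = s := by
    -- The cross product with `(p, q)` eliminates `t`; below, the one with the direction of the edge
    -- eliminates `s`.
    have e : (s' - s) * ((p : ℝ) * τ.dir.vec.2 - q * τ.dir.vec.1) = 0 := by
      linear_combination p * (m2' - m2) - q * (m1' - m1)
    rcases mul_eq_zero.mp e with e | e
    · linarith
    · exact absurd e tr2
  have et : t' = t := by
    have e : (t' - t) * ((p : ℝ) * τ.dir.vec.2 - q * τ.dir.vec.1) = 0 := by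
      linear_combination τ.dir.vec.1 * (m2' - m2) - τ.dir.vec.2 * (m1' - m1)
    rcases mul_eq_zero.mp e with e | e
    · linarith
    · exact absurd e tr2
  subst es et
  rfl

theorem abs_le_of_meet {a d p : ℤ} {s t : ℝ} (hd : |d| ≤ 1) (s0 : 0 < s) (s1 : s < 1)
    (t0 : 0 < t) (t1 : t < 1) (h : (a : ℝ) + s * d = t * p) : |a| ≤ |p| + 1 := by
  have hd' : |(d : ℝ)| ≤ 1 := by exact_mod_cast hd
  have h1 : |(a : ℝ)| ≤ |(p : ℝ)| + 1 := by
    calc |(a : ℝ)| = |t * p - s * d| := by rw [← h]; ring_nf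
      _ ≤ |t * p| + |s * d| := abs_sub _ _
      _ = t * |(p : ℝ)| + s * |(d : ℝ)| := by rw [abs_mul, abs_mul, abs_of_pos s0, abs_of_pos t0]
      _ ≤ 1 * |(p : ℝ)| + 1 * 1 := by gcongr
      _ = _ := by ring
  exact_mod_cast h1

instance : Finite Dir :=
  Finite.of_surjective (fun i : Fin 3 => ![Dir.horizontal, .vertical, .diagonal] i)
    fun d => by cases d; exacts [⟨0, rfl⟩, ⟨1, rfl⟩, ⟨2, rfl⟩]

theorem _root_.KMarkov.Dir.abs_vec_le (d : Dir) : |d.vec.1| ≤ 1 ∧ |d.vec.2| ≤ 1 := by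
  cases d <;> simp [Dir.vec]

instance : Finite (Crossing p q) := by
  let f : Crossing p q → Set.Icc (-(|p| + 1)) (|p| + 1) × Set.Icc (-(|q| + 1)) (|q| + 1) × Dir :=
    fun c => ⟨⟨c.edge.src.1, abs_le.1 (abs_le_of_meet c.edge.dir.abs_vec_le.1 c.s_pos c.s_lt_one
      c.t_pos c.t_lt_one c.meet_fst)⟩, ⟨c.edge.src.2, abs_le.1 (abs_le_of_meet
      c.edge.dir.abs_vec_le.2 c.s_pos c.s_lt_one c.t_pos c.t_lt_one c.meet_snd)⟩, c.edge.dir⟩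
  refine Finite.of_injective f fun c c' h => edge_injective ?_
  simp only [f, Prod.mk.injEq] at h
  obtain ⟨h1, h2, h3⟩ := h
  have h1 := Subtype.mk.inj h1
  have h2 := Subtype.mk.inj h2
  show c.edge = c'.edge
  rcases hc : c.edge with ⟨⟨x, y⟩, d⟩
  rcases hc' : c'.edge with ⟨⟨x', y'⟩, d'⟩
  simp_all

/-- The side of `γ` on which the endpoints of a crossed line segment lie. -/
theorem side_src (c : Crossing p q) : ((p * c.edge.src.2 - q * c.edge.src.1 : ℤ) : ℝ) =
    - c.s * ((p * c.edge.dir.vec.2 - q * c.edge.dir.vec.1 : ℤ) : ℝ) := by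
  push_cast
  linear_combination p * c.meet_snd - q * c.meet_fst

theorem side_tgt (c : Crossing p q) : ((p * c.edge.tgt.2 - q * c.edge.tgt.1 : ℤ) : ℝ) =
    (1 - c.s) * ((p * c.edge.dir.vec.2 - q * c.edge.dir.vec.1 : ℤ) : ℝ) := by
  simp only [Edge.tgt, Prod.fst_add, Prod.snd_add]
  push_cast
  linear_combination p * c.meet_snd - q * c.meet_fst

theorem rightOf_src (c : Crossing p q) :
    RightOf p q c.edge.src ↔ 0 < p * c.edge.dir.vec.2 - q * c.edge.dir.vec.1 := by
  rw [RightOf, ← Int.cast_lt (R := ℝ), side_src, Int.cast_zero, neg_mul, neg_lt_zero,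
    mul_pos_iff_of_pos_left c.s_pos, Int.cast_pos]

theorem rightOf_tgt (c : Crossing p q) :
    RightOf p q c.edge.tgt ↔ p * c.edge.dir.vec.2 - q * c.edge.dir.vec.1 < 0 := by
  rw [RightOf, ← Int.cast_lt (R := ℝ), side_tgt, Int.cast_zero,
    ← smul_eq_mul, smul_neg_iff_of_pos_left (sub_pos.2 c.s_lt_one), Int.cast_lt_zero]

/-- An endpoint on the line of `γ` would force `s = 0` or `s = 1` by transversality. Thus every
common endpoint gives its link a direction. -/
theorem rightOf_or_leftOf (c : Crossing p q) {v : ℤ × ℤ} (hv : c.edge.IsEndpoint v) :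
    RightOf p q v ∨ LeftOf p q v := by
  refine lt_or_gt_of_ne fun h => ?_
  have tr : ((p * c.edge.dir.vec.2 - q * c.edge.dir.vec.1 : ℤ) : ℝ) ≠ 0 :=
    Int.cast_ne_zero.2 c.transversal
  rcases hv with rfl | rfl
  · have h1 := c.side_src
    rw [h, Int.cast_zero] at h1
    exact mul_ne_zero (neg_ne_zero.2 c.s_pos.ne') tr h1.symm
  · have h1 := c.side_tgt
    rw [h, Int.cast_zero] at h1
    exact mul_ne_zero (sub_pos.2 c.s_lt_one).ne' tr h1.symm

/-! ### The half turn and the middle crossing -/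

/-- The rotation by a half turn about the midpoint of `γ`. -/
@[simps] def rotate (c : Crossing p q) : Crossing p q where
  edge := ⟨(p, q) - c.edge.tgt, c.edge.dir⟩
  s := 1 - c.s
  t := 1 - c.t
  s_pos := sub_pos.2 c.s_lt_one
  s_lt_one := by linarith [c.s_pos]
  t_pos := sub_pos.2 c.t_lt_one
  t_lt_one := by linarith [c.t_pos]
  meet_fst := by
    simp only [Edge.tgt, Prod.fst_sub, Prod.fst_add]
    push_cast
    linear_combination - c.meet_fst
  meet_snd := by
    simp only [Edge.tgt, Prod.snd_sub, Prod.snd_add]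
    push_cast
    linear_combination - c.meet_snd
  transversal := c.transversal

theorem rotate_rotate (c : Crossing p q) : c.rotate.rotate = c := t_injective (by simp)

theorem isEndpoint_rotate (c : Crossing p q) {v : ℤ × ℤ} (hv : c.edge.IsEndpoint v) :
    c.rotate.edge.IsEndpoint ((p, q) - v) := by
  rcases hv with rfl | rfl
  · right
    simp only [Edge.tgt, rotate_edge_src, rotate_edge_dir]
    abel
  · left
    simp

theorem _root_.KMarkov.leftOf_rotate {v : ℤ × ℤ} : LeftOf p q ((p, q) - v) ↔ RightOf p q v := by
  simp only [LeftOf, RightOf, Prod.fst_sub, Prod.snd_sub]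
  constructor <;> intro h <;> linarith

theorem _root_.KMarkov.rightOf_rotate {v : ℤ × ℤ} : RightOf p q ((p, q) - v) ↔ LeftOf p q v := by
  simp only [LeftOf, RightOf, Prod.fst_sub, Prod.snd_sub]
  constructor <;> intro h <;> linarith

theorem Consecutive.rotate {c c' : Crossing p q} (h : c.Consecutive c') :
    c'.rotate.Consecutive c.rotate := by
  refine ⟨by simpa using h.1, fun d hd => h.2 d.rotate ?_⟩
  simp only [rotate_t] at hd ⊢
  constructor <;> linarith [hd.1, hd.2]

/-- Twice the midpoint of an edge is integral, so `2t • (p, q)` is integral; by Bézout `2t` is an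
integer, and it lies strictly between `0` and `2`. -/
theorem t_eq_half_of_s_eq_half (hpq : IsCoprime p q) (c : Crossing p q) (h : c.s = 1 / 2) :
    c.t = 1 / 2 := by
  obtain ⟨u, v, huv⟩ := hpq
  have huv' : (u : ℝ) * p + v * q = 1 := by exact_mod_cast huv
  have h1 : 2 * c.t = ((u * (2 * c.edge.src.1 + c.edge.dir.vec.1) +
      v * (2 * c.edge.src.2 + c.edge.dir.vec.2) : ℤ) : ℝ) := by
    have e1 := c.meet_fst
    have e2 := c.meet_snd
    rw [h] at e1 e2
    push_cast
    linear_combination (-2 * c.t) * huv' - 2 * u * e1 - 2 * v * e2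
  have h2 := c.t_pos
  have h3 := c.t_lt_one
  generalize u * (2 * c.edge.src.1 + c.edge.dir.vec.1) +
      v * (2 * c.edge.src.2 + c.edge.dir.vec.2) = m at h1
  have h4 : (0 : ℝ) < m := by linarith
  have h5 : (m : ℝ) < 2 := by linarith
  norm_cast at h4 h5
  have h6 : m = 1 := by omega
  rw [h6, Int.cast_one] at h1
  linarith

theorem closerToRight_iff (c : Crossing p q) : c.CloserToRight ↔
    (0 < p * c.edge.dir.vec.2 - q * c.edge.dir.vec.1 ∧ c.s < 1 / 2) ∨
      (p * c.edge.dir.vec.2 - q * c.edge.dir.vec.1 < 0 ∧ 1 / 2 < c.s) := by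
  rw [CloserToRight, rightOf_src, rightOf_tgt]

/-- The half turn keeps the direction of the edge and sends `s` to `1 - s`. Only a tie `s = 1 / 2`
could spoil the equivalence, and ties occur only at `t = 1 / 2`. -/
theorem closerToRight_rotate (hpq : IsCoprime p q) (c : Crossing p q) (h : c.t ≠ 1 / 2) :
    c.rotate.CloserToRight ↔ ¬ c.CloserToRight := by
  have hs : c.s ≠ 1 / 2 := fun hs => h (c.t_eq_half_of_s_eq_half hpq hs)
  rw [closerToRight_iff, closerToRight_iff]
  simp only [rotate_edge_dir, rotate_s]
  rcases lt_or_gt_of_ne c.transversal with hd | hd <;> rcases lt_or_gt_of_ne hs with hs | hs <;>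
    constructor <;> intro h <;> grind

/-- `γ` crosses a line segment of `𝓛` in its midpoint. -/
theorem exists_middle (hpq : IsCoprime p q) (hp : p ≠ 0) (hq : q ≠ 0) (hsum : p + q ≠ 0) :
    ∃ c : Crossing p q, c.t = 1 / 2 ∧ ¬ c.CloserToRight := by
  suffices h : ∃ c : Crossing p q, c.t = 1 / 2 ∧ c.s = 1 / 2 by
    obtain ⟨c, h1, h2⟩ := h
    refine ⟨c, h1, ?_⟩
    rw [closerToRight_iff, h2]
    simp
  -- The point `(p/2, q/2)` is half-integral but not integral, and the parities of `p` and `q` tell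
  -- which kind of edge it bisects.
  rcases Int.even_or_odd' p with ⟨a, rfl | rfl⟩ <;> rcases Int.even_or_odd' q with ⟨b, rfl | rfl⟩
  · exfalso
    have h2 : IsUnit (2 : ℤ) := hpq.isUnit_of_dvd' (dvd_mul_right _ _) (dvd_mul_right _ _)
    exact absurd (Int.isUnit_iff.1 h2) (by norm_num)
  · exact ⟨⟨⟨(a, b), .vertical⟩, 1 / 2, 1 / 2, by norm_num, by norm_num, by norm_num, by norm_num,
      by simp [Dir.vec], by simp [Dir.vec]; ring, by simpa [Dir.vec] using hp⟩, rfl, rfl⟩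
  · exact ⟨⟨⟨(a, b), .horizontal⟩, 1 / 2, 1 / 2, by norm_num, by norm_num, by norm_num, by norm_num,
      by simp [Dir.vec]; ring, by simp [Dir.vec], by simpa [Dir.vec] using hq⟩, rfl, rfl⟩
  · exact ⟨⟨⟨(a + 1, b), .diagonal⟩, 1 / 2, 1 / 2, by norm_num, by norm_num, by norm_num,
      by norm_num, by simp [Dir.vec]; ring, by simp [Dir.vec]; ring,
      by simp only [Dir.vec]; omega⟩, rfl, rfl⟩

/-! ### The triangulation: consecutive edges share an endpoint -/

/-- By Bézout `t` itself would be an integer. So `γ` meets the lines of `𝓛` only in the interior of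
edges. -/
theorem not_both_integral (hpq : IsCoprime p q) {t : ℝ} (t0 : 0 < t) (t1 : t < 1) (a b : ℤ)
    (ha : t * p = a) (hb : t * q = b) : False := by
  obtain ⟨u, v, huv⟩ := hpq
  have huv' : (u : ℝ) * p + v * q = 1 := by exact_mod_cast huv
  have h : t = ((u * a + v * b : ℤ) : ℝ) := by
    push_cast
    linear_combination (-t) * huv' + u * ha + v * hb
  rw [h] at t0 t1
  norm_cast at t0 t1
  omega

theorem fract_pos_of_ne {x : ℝ} (h : ∀ a : ℤ, x ≠ a) : 0 < Int.fract x :=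
  Int.fract_pos.2 (h _)

/-- `γ` crosses a line segment of `𝓛` wherever it meets one of the lines. -/
theorem exists_of_integral (hpq : IsCoprime p q) (hp : p ≠ 0) (hq : q ≠ 0) (hsum : p + q ≠ 0)
    {t : ℝ} (t0 : 0 < t) (t1 : t < 1) {r : ℤ} (hr : r = p ∨ r = q ∨ r = p + q) (a : ℤ)
    (h : t * r = a) : ∃ c : Crossing p q, c.t = t := by
  rcases hr with rfl | rfl | rfl
  · have hf := fract_pos_of_ne fun b hb => not_both_integral hpq t0 t1 a b h hb
    refine ⟨⟨⟨(a, ⌊t * q⌋), .vertical⟩, Int.fract (t * q), t, hf, Int.fract_lt_one _, t0, t1,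
      ?_, ?_, by simpa [Dir.vec] using hp⟩, rfl⟩
    · simp [Dir.vec, h]
    · simp [Dir.vec, Int.floor_add_fract]
  · have hf := fract_pos_of_ne fun b hb => not_both_integral hpq t0 t1 b a hb h
    refine ⟨⟨⟨(⌊t * p⌋, a), .horizontal⟩, Int.fract (t * p), t, hf, Int.fract_lt_one _, t0, t1,
      ?_, ?_, by simpa [Dir.vec] using hq⟩, rfl⟩
    · simp [Dir.vec, Int.floor_add_fract]
    · simp [Dir.vec, h]
  · push_cast at h
    have hf := fract_pos_of_ne fun b hb => not_both_integral hpq t0 t1 (a - b) b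
      (by push_cast; linarith) hb
    refine ⟨⟨⟨(a - ⌊t * q⌋, ⌊t * q⌋), .diagonal⟩, Int.fract (t * q), t, hf, Int.fract_lt_one _,
      t0, t1, ?_, ?_, by simpa [Dir.vec] using hsum⟩, rfl⟩
    · have := Int.floor_add_fract (t * q)
      simp only [Dir.vec]
      push_cast
      linarith
    · simp [Dir.vec, Int.floor_add_fract]

theorem exists_floor_of_no_integral {x y : ℝ} (h : ∀ z : ℤ, x < z → ¬ (z : ℝ) < y) :
    ∃ a : ℤ, a ≤ x ∧ y ≤ a + 1 := by
  refine ⟨⌊x⌋, Int.floor_le x, ?_⟩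
  have := h (⌊x⌋ + 1) (by push_cast; exact Int.lt_floor_add_one x)
  push_cast at this
  exact not_lt.1 this

/-- Between consecutive crossings, `γ` stays between two neighbouring lines of each direction. -/
theorem Consecutive.exists_strip (hpq : IsCoprime p q) (hp : p ≠ 0) (hq : q ≠ 0)
    (hsum : p + q ≠ 0) {c c' : Crossing p q} (h : c.Consecutive c') {r : ℤ}
    (hr : r = p ∨ r = q ∨ r = p + q) :
    ∃ a : ℤ, (a ≤ c.t * r ∧ c.t * r ≤ a + 1) ∧ (a ≤ c'.t * r ∧ c'.t * r ≤ a + 1) ∧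
      (a < (c.t + c'.t) / 2 * r ∧ (c.t + c'.t) / 2 * r < a + 1) := by
  have hr0 : r ≠ 0 := by rcases hr with rfl | rfl | rfl <;> assumption
  have key : ∀ z : ℤ, ¬ (c.t < z / r ∧ z / r < c'.t) := by
    rintro z ⟨h1, h2⟩
    obtain ⟨d, hd⟩ := exists_of_integral hpq hp hq hsum (c.t_pos.trans h1) (h2.trans c'.t_lt_one)
      hr z (div_mul_cancel₀ _ (Int.cast_ne_zero.2 hr0))
    exact h.2 d (by rw [hd]; exact ⟨h1, h2⟩)
  have ht := h.1
  rcases lt_or_gt_of_ne hr0 with hr1 | hr1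
  · have hr2 : (r : ℝ) < 0 := by exact_mod_cast hr1
    have hlt := mul_lt_mul_of_neg_right ht hr2
    obtain ⟨a, h1, h2⟩ := exists_floor_of_no_integral fun z h1 h2 =>
      key z ⟨(lt_div_iff_of_neg hr2).2 h2, (div_lt_iff_of_neg hr2).2 h1⟩
    exact ⟨a, by constructor <;> linarith, by constructor <;> linarith, by constructor <;> linarith⟩
  · have hr2 : (0 : ℝ) < r := by exact_mod_cast hr1
    have hlt := mul_lt_mul_of_pos_right ht hr2
    obtain ⟨a, h1, h2⟩ := exists_floor_of_no_integral fun z h1 h2 =>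
      key z ⟨(lt_div_iff₀ hr2).2 h1, (div_lt_iff₀ hr2).2 h2⟩
    exact ⟨a, by constructor <;> linarith, by constructor <;> linarith, by constructor <;> linarith⟩

theorem eq_of_mem_strip {a m : ℤ} {s x : ℝ} (s0 : 0 < s) (s1 : s < 1) (hx : m + s = x)
    (h1 : a ≤ x) (h2 : x ≤ a + 1) : m = a := by
  have h3 : (m : ℝ) < a + 1 := by linarith
  have h4 : (a : ℝ) < m + 1 := by linarith
  norm_cast at h3 h4
  omega

/-- A line segment crossed at the boundary of a triangle of the triangulation is a side of it. -/
theorem src_eq_of_mem_strips (c : Crossing p q) {a b e : ℤ}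
    (ha : a ≤ c.t * p ∧ c.t * p ≤ a + 1) (hb : b ≤ c.t * q ∧ c.t * q ≤ b + 1)
    (he : e ≤ c.t * (p + q : ℤ) ∧ c.t * (p + q : ℤ) ≤ e + 1) :
    c.edge = ⟨(a, e - a), .horizontal⟩ ∨ c.edge = ⟨(e - b, b), .vertical⟩ ∨
      c.edge = ⟨(a + 1, b), .diagonal⟩ := by
  obtain ⟨⟨⟨x, y⟩, d⟩, s, t, s0, s1, t0, t1, m1, m2, tr⟩ := c
  push_cast at he
  rw [mul_add] at he
  simp only at *
  rw [← m1, ← m2] at he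
  rw [← m1] at ha
  rw [← m2] at hb
  cases d <;> simp only [Dir.vec, Int.cast_one, Int.cast_zero, mul_one, mul_zero, add_zero,
        Int.cast_neg, mul_neg] at ha hb he
  · left
    have h1 := eq_of_mem_strip s0 s1 rfl ha.1 ha.2
    have h2 : x + y = e := eq_of_mem_strip s0 s1 (by push_cast; ring) he.1 he.2
    simp only [Edge.mk.injEq, Prod.mk.injEq, and_true]
    omega
  · right; left
    have h1 := eq_of_mem_strip s0 s1 rfl hb.1 hb.2
    have h2 : x + y = e := eq_of_mem_strip s0 s1 (by push_cast; ring) he.1 he.2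
    simp only [Edge.mk.injEq, Prod.mk.injEq, and_true]
    omega
  · right; right
    have h1 := eq_of_mem_strip s0 s1 rfl hb.1 hb.2
    -- A diagonal edge runs towards smaller first coordinates: `x - s = (x - 1) + (1 - s)`.
    have h2 : x - 1 = a := eq_of_mem_strip (sub_pos.2 s1) (sub_lt_self 1 s0)
      (by push_cast; ring) ha.1 ha.2
    simp only [Edge.mk.injEq, Prod.mk.injEq, and_true]
    omega

/-- Between two consecutive crossings `γ` stays in one triangle of the triangulation, and any two
sides of a triangle meet. -/
theorem Consecutive.exists_common_endpoint (hpq : IsCoprime p q) (hp : p ≠ 0) (hq : q ≠ 0)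
    (hsum : p + q ≠ 0) {c c' : Crossing p q} (h : c.Consecutive c') :
    ∃ v, c.edge.IsEndpoint v ∧ c'.edge.IsEndpoint v := by
  obtain ⟨a, ha, ha', ha''⟩ := h.exists_strip hpq hp hq hsum (r := p) (by simp)
  obtain ⟨b, hb, hb', hb''⟩ := h.exists_strip hpq hp hq hsum (r := q) (by simp)
  obtain ⟨e, he, he', he''⟩ := h.exists_strip hpq hp hq hsum (r := p + q) (by simp)
  have hc := c.src_eq_of_mem_strips ha hb he
  have hc' := c'.src_eq_of_mem_strips ha' hb' he'
  -- The first two strips cut out a unit square and `e` selects one of its two triangles. The strict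
  -- bounds at the intermediate time exclude all other values.
  have hcell : e = a + b ∨ e = a + b + 1 := by
    push_cast at he''
    have h1 : (e : ℝ) < a + b + 2 := by linarith
    have h2 : (a : ℝ) + b < e + 1 := by linarith
    norm_cast at h1 h2
    omega
  rcases hcell with rfl | rfl <;> rcases hc with hc | hc | hc <;>
    rcases hc' with hc' | hc' | hc' <;> rw [hc, hc'] <;>
    simp only [Edge.IsEndpoint, Edge.tgt, Dir.vec, Prod.mk_add_mk] <;>
    first
    | exact ⟨_, .inl rfl, by grind⟩
    | exact ⟨_, .inr rfl, by grind⟩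

end Crossing

/-! ### Enumerations and their reversal -/

theorem exists_equiv_fin_strictMono {α β : Type*} [Finite α] [Nonempty α] [LinearOrder β]
    {f : α → β} (hf : Function.Injective f) :
    ∃ (n : ℕ) (e : Fin (n + 1) ≃ α), StrictMono fun i => f (e i) := by
  classical
  have := Fintype.ofFinite α
  let : LinearOrder α := LinearOrder.lift' f hf
  obtain ⟨n, hn⟩ := Nat.exists_eq_succ_of_ne_zero (Fintype.card_ne_zero (α := α))
  let e := monoEquivOfFin α hn
  exact ⟨n, e.toEquiv, fun i j hij => e.strictMono hij⟩

theorem exists_castSucc_of_neighbours {n : ℕ} {i j : Fin (n + 1)} (h : i < j)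
    (h' : ∀ l, ¬ (i < l ∧ l < j)) : ∃ l : Fin n, i = l.castSucc ∧ j = l.succ := by
  have h1 : i.val < n := by omega
  refine ⟨⟨i, h1⟩, rfl, ?_⟩
  have h2 := h' ⟨i + 1, by omega⟩
  simp only [Fin.lt_def, Fin.ext_iff, Fin.val_succ] at *
  omega

/-- An order-reversing involution reverses the enumeration. -/
theorem enumeration_rev {α β : Type*} [LinearOrder β] {f : α → β} (hf : Function.Injective f)
    {n : ℕ} (e : Fin (n + 1) ≃ α) (he : StrictMono fun i => f (e i)) (ρ : α → α)
    (hρ : ∀ x, ρ (ρ x) = x) (hanti : ∀ x y, f x < f y → f (ρ y) < f (ρ x)) (i : Fin (n + 1)) :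
    e i.rev = ρ (e i) := by
  have h1 : StrictMono fun i : Fin (n + 1) => f (ρ (e i.rev)) := fun i j hij =>
    hanti _ _ (he (Fin.rev_lt_rev.2 hij))
  have h2 := (he.range_inj h1).1 (by
    ext y
    constructor
    · rintro ⟨i, rfl⟩
      exact ⟨(e.symm (ρ (e i))).rev, by simp [hρ]⟩
    · rintro ⟨i, rfl⟩
      exact ⟨e.symm (ρ (e i.rev)), by simp⟩)
  have h3 := hf (congrFun h2 i.rev)
  simpa using h3

/-! ### The word of the fence and its symmetry -/

namespace Fence

instance : Finite (Fence k p q) :=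
  Finite.of_injective (fun x => (x.crossing, x.level)) fun x y h => by
    simp only [Prod.mk.injEq] at h
    exact Fence.ext h.1 h.2

/-- The rotation of the fence that is induced by the half turn about the midpoint of `γ`. -/
@[simps] def rotate (x : Fence k p q) : Fence k p q := ⟨x.crossing.rotate, x.level.rev⟩

theorem rotate_rotate (x : Fence k p q) : x.rotate.rotate = x :=
  Fence.ext (Crossing.rotate_rotate _) (Fin.rev_rev _)

theorem place_rotate_lt {x y : Fence k p q} (h : place x < place y) :
    place y.rotate < place x.rotate := by
  rw [place_lt] at h ⊢
  simp only [rotate_crossing, rotate_level, Crossing.rotate_t, Fin.rev_lt_rev]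
  rcases h with h | ⟨h, h'⟩
  · exact .inl (by linarith)
  · exact .inr ⟨by linarith, h'⟩

/-- The half turn preserves the relations of the fence outside the middle crossing. -/
theorem Step.rotate (hpq : IsCoprime p q) {x y : Fence k p q} (h : Step x y)
    (hmid : x.crossing = y.crossing → x.crossing.t ≠ 1 / 2) : Step x.rotate y.rotate := by
  cases h with
  | chainDown c i h =>
    -- The type of the chain and the order of its levels are both reversed, so the relation keeps
    -- its direction.
    have := Step.chainUp c.rotate i.rev
      (by rw [c.closerToRight_rotate hpq (hmid rfl)]; exact not_not.2 h)
    simpa only [Fence.rotate, Fin.rev_succ, Fin.rev_castSucc] using this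
  | chainUp c i h =>
    have := Step.chainDown c.rotate i.rev ((c.closerToRight_rotate hpq (hmid rfl)).2 h)
    simpa only [Fence.rotate, Fin.rev_succ, Fin.rev_castSucc] using this
  | linkDown c c' v h hc hc' hv =>
    have := Step.linkUp (k := k) c'.rotate c.rotate _ h.rotate (c'.isEndpoint_rotate hc')
      (c.isEndpoint_rotate hc) (leftOf_rotate.2 hv)
    simpa only [Fence.rotate, Fin.rev_zero, Fin.rev_last] using this
  | linkUp c c' v h hc hc' hv =>
    have := Step.linkDown (k := k) c'.rotate c.rotate _ h.rotate (c'.isEndpoint_rotate hc')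
      (c.isEndpoint_rotate hc) (rightOf_rotate.2 hv)
    simpa only [Fence.rotate, Fin.rev_zero, Fin.rev_last] using this

/-- Neighbours along `γ` are related. -/
theorem step_or_step_of_neighbours (hpq : IsCoprime p q) (hp : p ≠ 0) (hq : q ≠ 0)
    (hsum : p + q ≠ 0) {x y : Fence k p q} (h : place x < place y)
    (h' : ∀ z : Fence k p q, ¬ (place x < place z ∧ place z < place y)) : Step x y ∨ Step y x := by
  obtain ⟨c, i⟩ := x
  obtain ⟨c', j⟩ := y
  simp only [place_lt] at h h'
  rcases h with h | ⟨h, hij⟩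
  · have hi : i = Fin.last k := by
      by_contra hi
      exact h' ⟨c, Fin.last k⟩ ⟨.inr ⟨rfl, Fin.lt_last_iff_ne_last.2 hi⟩, .inl h⟩
    have hj : j = 0 := by
      by_contra hj
      exact h' ⟨c', 0⟩ ⟨.inl h, .inr ⟨rfl, Fin.pos_iff_ne_zero.2 hj⟩⟩
    subst hi hj
    have hcons : c.Consecutive c' := ⟨h, fun d hd => h' ⟨d, 0⟩ ⟨.inl hd.1, .inl hd.2⟩⟩
    obtain ⟨v, hv, hv'⟩ := hcons.exists_common_endpoint hpq hp hq hsum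
    rcases c.rightOf_or_leftOf hv with hs | hs
    · exact .inr (.linkDown c c' v hcons hv hv' hs)
    · exact .inl (.linkUp c c' v hcons hv hv' hs)
  · obtain rfl : c = c' := Crossing.t_injective h
    obtain ⟨l, rfl, rfl⟩ := exists_castSucc_of_neighbours hij
      fun l hl => h' ⟨c, l⟩ ⟨.inr ⟨rfl, hl.1⟩, .inr ⟨rfl, hl.2⟩⟩
    by_cases hc : c.CloserToRight
    · exact .inr (.chainDown c l hc)
    · exact .inl (.chainUp c l hc)

theorem isFirst_iff {x₀ : Fence k p q} (h₀ : ∀ z : Fence k p q, place x₀ ≤ place z) (x : Fence k p q) :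
    x.IsFirst ↔ x = x₀ := by
  have hfirst : x₀.IsFirst := by
    refine ⟨?_, fun d => ?_⟩
    · by_contra h
      exact not_lt.2 (h₀ ⟨x₀.crossing, 0⟩)
        (place_lt.2 (.inr ⟨rfl, Fin.pos_iff_ne_zero.2 h⟩))
    · by_contra h
      exact not_lt.2 (h₀ ⟨d, 0⟩) (place_lt.2 (.inl (not_le.1 h)))
  refine ⟨fun h => ?_, fun h => h ▸ hfirst⟩
  exact Fence.ext (Crossing.t_injective (le_antisymm (h.2 _) (hfirst.2 _)))
    (h.1.trans hfirst.1.symm)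

theorem isLast_iff {x₀ : Fence k p q} (h₀ : ∀ z : Fence k p q, place z ≤ place x₀) (x : Fence k p q) :
    x.IsLast ↔ x = x₀ := by
  have hlast : x₀.IsLast := by
    refine ⟨?_, fun d => ?_⟩
    · by_contra h
      exact not_lt.2 (h₀ ⟨x₀.crossing, Fin.last k⟩)
        (place_lt.2 (.inr ⟨rfl, Fin.lt_last_iff_ne_last.2 h⟩))
    · by_contra h
      exact not_lt.2 (h₀ ⟨d, 0⟩) (place_lt.2 (.inl (not_le.1 h)))
  refine ⟨fun h => ?_, fun h => h ▸ hlast⟩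
  exact Fence.ext (Crossing.t_injective (le_antisymm (hlast.2 _) (h.2 _)))
    (h.1.trans hlast.1.symm)

-- The half turn exchanges positions `i` and `n - i` and preserves relations, so a rise before the
-- middle block mirrors a fall after it and conversely. This provides the hypotheses of
-- `card_first_sub_card_last`.
open Classical in
theorem exists_card_first_sub_card_last (hpq : IsCoprime p q) (hp : p ≠ 0) (hq : q ≠ 0)
    (hsum : p + q ≠ 0) : ∃ x₀ x₁ : Fence k p q, (∀ x, x.IsFirst ↔ x = x₀) ∧
      (∀ x, x.IsLast ↔ x = x₁) ∧ (Nat.card {I : LowerSet (Fence k p q) // x₀ ∈ I} : ℤ) -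
        Nat.card {I : LowerSet (Fence k p q) // x₁ ∈ I} = k := by
  obtain ⟨m, hm, hm'⟩ := Crossing.exists_middle hpq hp hq hsum
  have hmrot : m.rotate = m := Crossing.t_injective (by simp [hm]; norm_num)
  have : Nonempty (Fence k p q) := ⟨⟨m, 0⟩⟩
  obtain ⟨n, e, he⟩ := exists_equiv_fin_strictMono (place_injective (k := k) (p := p) (q := q))
  have hlt : ∀ i j, place (e i) < place (e j) ↔ i < j := fun i j => he.lt_iff_lt
  have hrev := enumeration_rev place_injective e he rotate rotate_rotate
    fun _ _ => place_rotate_lt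
  have hnb : ∀ x y : Fence k p q, place x < place y →
      (∀ z : Fence k p q, ¬ (place x < place z ∧ place z < place y)) →
      ∃ l : Fin n, x = e l.castSucc ∧ y = e l.succ := by
    intro x y hxy hz
    obtain ⟨i, rfl⟩ := e.surjective x
    obtain ⟨j, rfl⟩ := e.surjective y
    simp only [hlt] at hxy hz
    obtain ⟨l, rfl, rfl⟩ := exists_castSucc_of_neighbours hxy
      fun l => by have := hz (e l); rwa [hlt, hlt] at this
    exact ⟨l, rfl, rfl⟩
  have htot : ∀ i : Fin n, Step (e i.castSucc) (e i.succ) ∨ Step (e i.succ) (e i.castSucc) := by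
    intro i
    refine step_or_step_of_neighbours hpq hp hq hsum ((hlt _ _).2 Fin.castSucc_lt_succ) ?_
    intro z
    obtain ⟨l, rfl⟩ := e.surjective z
    rw [hlt, hlt]
    simp only [Fin.lt_def, Fin.val_castSucc, Fin.val_succ]
    omega
  -- the word of the fence
  let r : ℕ → Bool := fun i =>
    decide (∃ h : i < n, Step (e (Fin.castSucc ⟨i, h⟩)) (e (Fin.succ ⟨i, h⟩)))
  have hr : ∀ i : Fin n, r i = true ↔ Step (e i.castSucc) (e i.succ) := by
    intro i
    rw [decide_eq_true_iff]
    exact ⟨fun ⟨_, h⟩ => h, fun h => ⟨i.2, h⟩⟩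
  have hr' : ∀ i : Fin n, r i = false ↔ Step (e i.succ) (e i.castSucc) := by
    intro i
    rw [← Bool.not_eq_true, hr]
    exact ⟨(htot i).resolve_left, fun h h' => Step.asymm _ _ h h'⟩
  -- the middle crossing occupies the positions from `a` to `a + k`
  set a : ℕ := (e.symm ⟨m, 0⟩).val with ha
  have hmiddle : ∀ j (hj : j ≤ k), ∃ h : a + j < n + 1,
      e ⟨a + j, h⟩ = ⟨m, ⟨j, Nat.lt_succ_of_le hj⟩⟩ := by
    intro j
    induction j with
    | zero => exact fun _ => ⟨(e.symm ⟨m, 0⟩).isLt, by simp [ha]⟩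
    | succ j ih =>
      intro hj
      obtain ⟨h, hej⟩ := ih (by omega)
      obtain ⟨h1, h2⟩ := chain_neighbours m (⟨j, hj⟩ : Fin k)
      obtain ⟨l, hl, hl'⟩ := hnb _ _ h1 h2
      have h3 : e ⟨a + j, h⟩ = e l.castSucc := hej.trans hl
      have h4 := congrArg Fin.val (e.injective h3)
      simp only [Fin.val_castSucc] at h4
      refine ⟨by omega, ?_⟩
      have h5 : (⟨a + (j + 1), by omega⟩ : Fin (n + 1)) = l.succ := by
        ext
        simp only [Fin.val_succ]
        omega
      rw [h5, ← hl']
      rfl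
  -- The half turn fixes the middle crossing and exchanges the ends of its chain, so positions `a`
  -- and `a + k` are mirror images.
  have hn : n = 2 * a + k := by
    obtain ⟨h0, h0'⟩ := hmiddle 0 (Nat.zero_le k)
    obtain ⟨h1, h1'⟩ := hmiddle k le_rfl
    have h2 := hrev ⟨a + 0, h0⟩
    rw [h0'] at h2
    have h3 : rotate (⟨m, ⟨0, Nat.succ_pos k⟩⟩ : Fence k p q) = e ⟨a + k, h1⟩ := by
      rw [h1']
      refine Fence.ext hmrot ?_
      exact Fin.rev_zero k
    rw [h3] at h2
    have h4 := congrArg Fin.val (e.injective h2)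
    simp only [Fin.val_rev] at h4
    omega
  have hposition : ∀ i (h : i < n + 1), (e ⟨i, h⟩).crossing.t = 1 / 2 → a ≤ i := by
    intro i h ht
    have h1 : (e ⟨i, h⟩).crossing = m := Crossing.t_injective (ht.trans hm.symm)
    obtain ⟨h2, h3⟩ := hmiddle _ (Fin.is_le (e ⟨i, h⟩).level)
    have h4 := e.injective (h3.trans (Fence.ext (y := e ⟨i, h⟩) h1.symm rfl))
    have h5 := congrArg Fin.val h4
    simp only at h5
    omega
  have hfirst : ∀ z : Fence k p q, place (e 0) ≤ place z := by
    intro z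
    obtain ⟨l, rfl⟩ := e.surjective z
    exact he.monotone (Fin.zero_le l)
  have hlast : ∀ z : Fence k p q, place z ≤ place (e (Fin.last n)) := by
    intro z
    obtain ⟨l, rfl⟩ := e.surjective z
    exact he.monotone (Fin.le_last l)
  refine ⟨e 0, e (Fin.last n), isFirst_iff hfirst, isLast_iff hlast,
    card_first_sub_card_last e r Step (fun _ _ => Iff.rfl) ?_ (fun i => (hr i).1)
      (fun i => (hr' i).1) a k hn ?_ ?_⟩
  · intro x y h
    rcases Step.neighbours x y h with ⟨h1, h2⟩ | ⟨h1, h2⟩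
    · obtain ⟨l, rfl, rfl⟩ := hnb _ _ h1 h2
      exact ⟨l, .inl ⟨rfl, rfl, (hr l).2 h⟩⟩
    · obtain ⟨l, rfl, rfl⟩ := hnb _ _ h1 h2
      exact ⟨l, .inr ⟨rfl, rfl, (hr' l).2 h⟩⟩
  · intro j hj
    refine (hr ⟨a + j, by omega⟩).2 ?_
    obtain ⟨h1, h1'⟩ := hmiddle j hj.le
    obtain ⟨h2, h2'⟩ := hmiddle (j + 1) hj
    exact h1' ▸ h2' ▸ Step.chainUp m ⟨j, hj⟩ hm'
  · intro i hi
    have hi1 : i < n := by omega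
    have hi2 : 2 * a + k - 1 - i < n := by omega
    have e1 : e (Fin.castSucc ⟨2 * a + k - 1 - i, hi2⟩) = rotate (e (Fin.succ ⟨i, hi1⟩)) := by
      rw [← hrev]
      congr 1
      ext
      simp only [Fin.val_castSucc, Fin.val_rev, Fin.val_succ]
      omega
    have e2 : e (Fin.succ ⟨2 * a + k - 1 - i, hi2⟩) = rotate (e (Fin.castSucc ⟨i, hi1⟩)) := by
      rw [← hrev]
      congr 1
      ext
      simp only [Fin.val_castSucc, Fin.val_rev, Fin.val_succ]
      omega
    -- A position before `a` is not on the middle crossing, so its relation to the next element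
    -- survives the half turn.
    have hmid : (e (Fin.castSucc ⟨i, hi1⟩)).crossing.t ≠ 1 / 2 := fun h =>
      absurd (hposition _ _ h) (by simpa using hi)
    rcases hri : r i with _ | _
    · have h1 := ((hr' ⟨i, hi1⟩).1 hri).rotate hpq fun h => h ▸ hmid
      rw [← e1, ← e2] at h1
      exact (hr ⟨_, hi2⟩).2 h1
    · have h1 := ((hr ⟨i, hi1⟩).1 hri).rotate hpq fun h => hmid
      rw [← e1, ← e2] at h1
      exact (hr' ⟨_, hi2⟩).2 h1

end Fence

/-! ### Ideals of the circular poset -/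

theorem exists_threshold {n : ℕ} (S : Set (Fin n)) (hS : ∀ i j, i ≤ j → i ∈ S → j ∈ S) :
    ∃ t : Fin (n + 1), ∀ i : Fin n, i ∈ S ↔ t.val ≤ i.val := by
  classical
  by_cases h : ∃ i : ℕ, ∃ hi : i < n, (⟨i, hi⟩ : Fin n) ∈ S
  · obtain ⟨h1, h2⟩ := Nat.find_spec h
    refine ⟨⟨Nat.find h, by omega⟩, fun i => ⟨fun hi => Nat.find_min' h ⟨i.2, hi⟩, fun hi => ?_⟩⟩
    exact hS _ _ hi h2
  -- The extra threshold `n` stands for the empty segment.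
  · refine ⟨Fin.last n, fun i => ⟨fun hi => absurd ⟨i, i.2, hi⟩ h, fun hi => ?_⟩⟩
    rw [Fin.val_last] at hi
    omega

namespace Circular

/-- The pairs consisting of an ideal of the fence and a position in the chain that fit together. -/
def Fits (x₀ x₁ : Fence k p q) (I : LowerSet (Fence k p q)) (t : Fin (3 * k + 3 + 1)) : Prop :=
  (x₀ ∈ I → t ≠ Fin.last _) ∧ (t = 0 → x₁ ∈ I)

/-- The ideal that is determined by an ideal of the fence and a position in the chain. -/
def ideal {x₀ x₁ : Fence k p q} (hfirst : ∀ x : Fence k p q, x.IsFirst ↔ x = x₀)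
    (hlast : ∀ x : Fence k p q, x.IsLast ↔ x = x₁) (I : LowerSet (Fence k p q))
    (t : Fin (3 * k + 3 + 1)) (h : Fits x₀ x₁ I t) : LowerSet (Circular k p q) where
  carrier := {z | match z with
    | chain i => t.val ≤ i.val
    | fence x => x ∈ I}
  lower' := by
    intro y x hxy hy
    induction (show Relation.ReflTransGen Step x y from hxy) using
      Relation.ReflTransGen.head_induction_on with
    | refl => exact hy
    | head hab _ ih =>
      have ih := ih ‹_›
      cases hab with
      | fence u v huv => exact I.lower huv ih
      | chain i =>
        have : t.val ≤ i.castSucc.val := ih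
        show t.val ≤ i.succ.val
        simp at *
        omega
      | toFirst u hu =>
        have h1 : t ≠ Fin.last _ := h.1 ((hfirst u).1 hu ▸ ih)
        have h2 := Fin.lt_last_iff_ne_last.2 h1
        show t.val ≤ 3 * k + 2
        rw [Fin.lt_def, Fin.val_last] at h2
        omega
      | fromLast u hu =>
        have h1 : t.val ≤ 0 := ih
        rw [(hlast u).1 hu]
        exact h.2 (Fin.ext (by simpa using h1))

theorem chain_mem_of_le {J : LowerSet (Circular k p q)} {i j : Fin (3 * k + 3)} (hij : i ≤ j)
    (hi : chain i ∈ J) : chain j ∈ J := by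
  obtain ⟨d, hd⟩ := Nat.exists_eq_add_of_le (Fin.le_def.1 hij)
  induction d generalizing j with
  | zero => rwa [show j = i from Fin.ext (by omega)]
  | succ d ih =>
    have h1 := ih (j := ⟨i + d, by omega⟩) (Fin.le_def.2 (by simp)) rfl
    have h2 : Step (k := k) (p := p) (q := q) (chain j) (chain ⟨i + d, by omega⟩) := by
      have := Step.chain (p := p) (q := q) (⟨i + d, by omega⟩ : Fin (3 * k + 2))
      convert this using 2
      · exact Fin.ext (by simp; omega)
      · rfl
    exact J.lower (Relation.ReflTransGen.single h2) h1

/-- The chain is descending, so an ideal meets it in a final segment. The two relations joining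
chain and fence amount to the two conditions in `Fits`. -/
theorem ideal_bijective {x₀ x₁ : Fence k p q} (hfirst : ∀ x : Fence k p q, x.IsFirst ↔ x = x₀)
    (hlast : ∀ x : Fence k p q, x.IsLast ↔ x = x₁) : Function.Bijective
      fun z : Σ I : LowerSet (Fence k p q), {t : Fin (3 * k + 3 + 1) // Fits x₀ x₁ I t} =>
        ideal hfirst hlast z.1 z.2.1 z.2.2 := by
  constructor
  · rintro ⟨I, t, h⟩ ⟨I', t', h'⟩ heq
    have hmem : ∀ z, z ∈ ideal hfirst hlast I t h ↔ z ∈ ideal hfirst hlast I' t' h' := by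
      simp only at heq
      simp [heq]
    have h1 : I = I' := by
      ext x
      exact hmem (fence x)
    have h2 : ∀ i : Fin (3 * k + 3), t.val ≤ i.val ↔ t'.val ≤ i.val := fun i => hmem (chain i)
    have h3 : t = t' := by
      ext
      by_contra hne
      -- The smaller threshold is a genuine index of the chain, and testing membership there
      -- separates the two segments.
      rcases lt_or_gt_of_ne hne with hlt | hlt
      · have := h2 ⟨t, by omega⟩
        simp at this
        omega
      · have := h2 ⟨t', by omega⟩
        simp at this
        omega
    subst h1 h3
    rfl
  · intro J
    obtain ⟨t, ht⟩ := exists_threshold {i : Fin (3 * k + 3) | chain i ∈ J}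
      fun i j hij hi => chain_mem_of_le hij hi
    let I : LowerSet (Fence k p q) := ⟨{x | fence x ∈ J}, fun y x hxy hy =>
      J.lower (Relation.ReflTransGen.single (Step.fence x y hxy)) hy⟩
    have ht' : ∀ i, chain i ∈ J ↔ t.val ≤ i.val := ht
    refine ⟨⟨I, t, ?_, ?_⟩, ?_⟩
    · rintro h rfl
      have h1 : chain (Fin.last (3 * k + 2)) ∈ J :=
        J.lower (Relation.ReflTransGen.single (Step.toFirst x₀ ((hfirst _).2 rfl))) h
      rw [ht'] at h1
      simp at h1
    · rintro rfl
      have h1 : chain 0 ∈ J := (ht' 0).2 (Nat.zero_le _)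
      exact J.lower (Relation.ReflTransGen.single (Step.fromLast x₁ ((hlast _).2 rfl))) h1
    · ext z
      cases z with
      | chain i => exact (ht' i).symm
      | fence x => exact Iff.rfl

instance (k : ℕ) (p q : ℤ) : Finite (LowerSet (Fence k p q)) :=
  Finite.of_injective (fun I => (I : Set (Fence k p q))) SetLike.coe_injective

-- The two conditions concern different thresholds, the last one and `0`, so their exclusions are
-- subtracted independently from `3k + 4`.
open Classical in
theorem card_fits (x₀ x₁ : Fence k p q) (I : LowerSet (Fence k p q)) :
    (Nat.card {t : Fin (3 * k + 3 + 1) // Fits x₀ x₁ I t} : ℤ) =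
      3 * k + 3 - (if x₀ ∈ I then 1 else 0) + (if x₁ ∈ I then 1 else 0) := by
  have h1 : ∀ t : Fin (3 * k + 3 + 1), (if Fits x₀ x₁ I t then 1 else 0 : ℤ) =
      1 - (if t = Fin.last _ then if x₀ ∈ I then 1 else 0 else 0) -
        (if t = 0 then 1 - if x₁ ∈ I then 1 else 0 else 0) := by
    intro t
    have : (0 : Fin (3 * k + 3 + 1)) ≠ Fin.last _ := by simp [Fin.ext_iff]
    unfold Fits
    split_ifs <;> simp_all
  rw [Nat.card_eq_fintype_card, Fintype.card_subtype, Finset.card_filter]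
  push_cast
  rw [Finset.sum_congr rfl fun t _ => h1 t]
  simp only [Finset.sum_sub_distrib, Finset.sum_ite_eq', Finset.mem_univ, if_true,
    Finset.sum_const, Finset.card_univ, Fintype.card_fin]
  simp
  ring

open Classical in
theorem card_lowerSet {x₀ x₁ : Fence k p q} (hfirst : ∀ x : Fence k p q, x.IsFirst ↔ x = x₀)
    (hlast : ∀ x : Fence k p q, x.IsLast ↔ x = x₁) :
    (Nat.card (LowerSet (Circular k p q)) : ℤ) = (3 * k + 3) * markov k p q -
      Nat.card {I : LowerSet (Fence k p q) // x₀ ∈ I} +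
      Nat.card {I : LowerSet (Fence k p q) // x₁ ∈ I} := by
  have := Fintype.ofFinite (LowerSet (Fence k p q))
  have hcard : ∀ x : Fence k p q, (Nat.card {I : LowerSet (Fence k p q) // x ∈ I} : ℤ) =
      ∑ I : LowerSet (Fence k p q), if x ∈ I then 1 else 0 := by
    intro x
    rw [Nat.card_eq_fintype_card, Fintype.card_subtype, Finset.card_filter]
    push_cast
    rfl
  rw [← Nat.card_congr (Equiv.ofBijective _ (ideal_bijective hfirst hlast)), Nat.card_sigma]
  rw [Nat.cast_sum, Finset.sum_congr rfl fun I _ => card_fits x₀ x₁ I, hcard, hcard, markov,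
    Nat.card_eq_fintype_card]
  simp only [Finset.sum_add_distrib, Finset.sum_sub_distrib, Finset.sum_const, Finset.card_univ,
    nsmul_eq_mul]
  ring

end Circular

end KMarkov

theorem lemma3 (k : ℕ) (p q : ℤ) (hpq : IsCoprime p q)
    (hp : p ≠ 0) (hq : q ≠ 0) (hsum : p + q ≠ 0) :
    (Nat.card (LowerSet (KMarkov.Circular k p q)) : ℤ)
      = (3 + 3 * (k : ℤ)) * (KMarkov.markov k p q : ℤ) - (k : ℤ) := by
  obtain ⟨x₀, x₁, hfirst, hlast, h⟩ :=
    KMarkov.Fence.exists_card_first_sub_card_last (k := k) hpq hp hq hsum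
  rw [KMarkov.Circular.card_lowerSet hfirst hlast]
  linear_combination -h
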